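/- All graphs are finite and simple. A weak $K_t$-immersion in a graph $G$ consists of $t$ distinct vertices of $G$ (the end vertices) together with, for each pair of them, a path in $G$ joining the pair, such that the $\binom t2$ paths are pairwise edge-disjoint. It is a strong $K_t$-immersion if no internal vertex of any of the paths is an end vertex. A clique is a set of pairwise adjacent vertices; the empty set counts as a clique. There is $t_0$ such that for all $t \ge t_0$ and all $n \ge 1$, every graph on $n$ vertices with no strong $K_t$-immersion has at most $2^{t+(\log_2 t)^2}\, n$ cliques. The same bound holds for every graph on $n$ vertices with no weak $K_t$-immersion. For all $t \ge 2$ and $n \ge t-2$, the $n$-vertex graph formed by a clique $K$ on $t-2$ vertices and $n-t+2$ further vertices, each having neighborhood exactly $K$, has no weak (hence no strong) $K_t$-immersion and has exactly $2^{t-2}(n-t+3)$ cliques. Consequently the upper bound is sharp up to a factor $2^{O(\log^2 t)}$: there is an absolute constant $C$ such that for all $t \ge 2$ and $n \ge t-2$ some graph on $n$ vertices with no weak (hence no strong) $K_t$-immersion has at least $2^{-C(\log_2 t)^2}\cdot 2^{t+(\log_2 t)^2}\, n$ cliques. -/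

import Mathlib

namespace SimpleGraph

/-- A weak `H`-immersion in `G`: a one-to-one map `φ` on the vertices, together with one path of `G`
for each edge `uv` of `H`, with end vertices `φ u` and `φ v`, the paths of different edges of `H`
being edge-disjoint. The path of an edge is recorded once for each orientation of the edge, and
`path_symm` says that the two records are the same path read in the two directions. -/
structure WeakImmersion {U V : Type*} (H : SimpleGraph U) (G : SimpleGraph V) where
  φ : U ↪ V
  path : ∀ u v : U, H.Adj u v → G.Walk (φ u) (φ v)
  isPath : ∀ (u v : U) (h : H.Adj u v), (path u v h).IsPath
  path_symm : ∀ (u v : U) (h : H.Adj u v), path v u h.symm = (path u v h).reverse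
  edge_disjoint : ∀ (u v : U) (h : H.Adj u v) (u' v' : U) (h' : H.Adj u' v'),
    s(u, v) ≠ s(u', v') → List.Disjoint (path u v h).edges (path u' v' h').edges

/-- A strong `H`-immersion in `G`: a weak one in which no internal vertex of a path is in the image
of `φ`, that is, the only vertices of the path of `uv` in the image are its ends. -/
structure StrongImmersion {U V : Type*} (H : SimpleGraph U) (G : SimpleGraph V)
    extends WeakImmersion H G where
  internal : ∀ (u v : U) (h : H.Adj u v) (x : U),
    φ x ∈ (path u v h).support → x = u ∨ x = v

/-- `G` contains a weak `K_t`-immersion. -/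
def HasWeakCliqueImmersion {V : Type*} (G : SimpleGraph V) (t : ℕ) : Prop :=
  Nonempty (WeakImmersion (completeGraph (Fin t)) G)

/-- `G` contains a strong `K_t`-immersion. -/
def HasStrongCliqueImmersion {V : Type*} (G : SimpleGraph V) (t : ℕ) : Prop :=
  Nonempty (StrongImmersion (completeGraph (Fin t)) G)

/-- The number of cliques (of all sizes, the empty clique included) of a graph on a finite
vertex set. -/
noncomputable def numCliques {V : Type*} [Finite V] (G : SimpleGraph V) : ℕ :=
  {s : Finset V | G.IsClique (s : Set V)}.ncard

/-- The graph in which the vertices of `K` form a clique and each vertex outside `K` has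
neighborhood exactly `K`. -/
def cliqueWithPendants {V : Type*} (K : Set V) : SimpleGraph V where
  Adj u v := u ≠ v ∧ (u ∈ K ∨ v ∈ K)
  symm := ⟨fun _ _ h => ⟨h.1.symm, h.2.symm⟩⟩
  loopless := ⟨fun _ h => h.1 rfl⟩

end SimpleGraph

/-! Cliques are counted along degeneracy orderings, at three scales. Let `G` have no strong
`K_t`-immersion.

Cubic degeneracy (`exists_card_inter_nbhd_lt`): every nonempty vertex set spans a vertex of degree
at most `10 t ^ 3`, so the count costs a factor `n` and reduces to sets of that size. The proof
repeatedly splits off a small cluster of vertices with nearly equal neighborhoods; only one vertex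
outside the cluster can lose degree.

Logarithmic degeneracy (`exists_card_inter_nbhd_le_log`): a set of `k` vertices spans one of degree
at most `t (1 + log k)`. Split off a vertex of minimum degree by joining its neighbors in
nonadjacent pairs; the unpaired ones form a clique, hence number fewer than `t`, and the average
degrees change by terms that sum to a harmonic number. With `k ≤ 10 t ^ 3` this costs a polynomial
factor in `t` and reduces to sets of size below `t + 2 ^ j`, where `2 ^ j` is about `t ^ 1.2`.

Small sets (`cliquesIn_le_two_pow_choose`): in a set of size `t + s`, some vertex misses more than
`s / 2` vertices, itself included, since otherwise greedy paths of length at most two give an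
immersion. Each halving of the excess `s` costs a factor `2 ^ j`, in total `2 ^ (j (j + 1) / 2)`.

For the construction, an end vertex outside `K` has only `t - 2` edges for its `t - 1` paths. -/

namespace SimpleGraph

/-! ### Strong immersions from walks, and splitting off a vertex. -/

/-- Walks suffice for a strong clique immersion: they can be shortened to paths. -/
theorem hasStrongCliqueImmersion_of_walks {V : Type*} {G : SimpleGraph V} {t : ℕ}
    (φ : Fin t ↪ V) (R : Fin t → Fin t → Set (Sym2 V))
    (hR : ∀ e i j i' j', i < j → i' < j' → e ∈ R i j → e ∈ R i' j' → i = i' ∧ j = j')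
    (h : ∀ i j, i < j → ∃ p : G.Walk (φ i) (φ j), (∀ e ∈ p.edges, e ∈ R i j) ∧
      ∀ k, φ k ∈ p.support → k = i ∨ k = j) : G.HasStrongCliqueImmersion t := by
  classical
  choose p hp hs using h
  have hlt : ∀ {u v : Fin t}, (completeGraph (Fin t)).Adj u v → ¬ u < v → v < u :=
    fun h h' => lt_of_le_of_ne (not_lt.1 h') (Ne.symm h)
  let P : ∀ u v : Fin t, (completeGraph (Fin t)).Adj u v → G.Walk (φ u) (φ v) :=
    fun u v h => if h' : u < v then (p u v h').bypass else (p v u (hlt h h')).bypass.reverse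
  have hedge : ∀ u v h, ∃ i j, i < j ∧ s(i, j) = s(u, v) ∧ ∀ e ∈ (P u v h).edges, e ∈ R i j := by
    intro u v h
    by_cases h' : u < v
    · refine ⟨u, v, h', rfl, fun e he => hp u v h' e ?_⟩
      simp only [P, h', dite_true] at he
      exact Walk.edges_bypass_subset_edges _ he
    · refine ⟨v, u, hlt h h', Sym2.eq_swap, fun e he => hp v u (hlt h h') e ?_⟩
      simp only [P, h', dite_false, Walk.edges_reverse, List.mem_reverse] at he
      exact Walk.edges_bypass_subset_edges _ he
  refine ⟨⟨⟨φ, P, ?_, ?_, ?_⟩, ?_⟩⟩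
  · intro u v h
    by_cases h' : u < v
    · simp only [P, h', dite_true]
      exact Walk.bypass_isPath _
    · simp only [P, h', dite_false]
      exact (Walk.bypass_isPath _).reverse
  · intro u v h
    by_cases h' : u < v
    · simp [P, h', not_lt.2 h'.le]
    · have := hlt h h'
      simp [P, h', this]
  · intro u v h u' v' h' hne e he he'
    obtain ⟨i, j, hij, hs1, h1⟩ := hedge u v h
    obtain ⟨i', j', hij', hs2, h2⟩ := hedge u' v' h'
    obtain ⟨rfl, rfl⟩ := hR e i j i' j' hij hij' (h1 e he) (h2 e he')
    exact hne (hs1.symm.trans hs2)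
  · intro u v h x hx
    by_cases h' : u < v
    · simp only [P, h', dite_true] at hx
      exact hs u v h' x (Walk.support_bypass_subset_support _ hx)
    · simp only [P, h', dite_false, Walk.support_reverse, List.mem_reverse] at hx
      exact (hs v u (hlt h h') x (Walk.support_bypass_subset_support _ hx)).symm

/-- If the edges of `G'` can be replaced by edge-disjoint walks of `G` whose internal vertices are
isolated in `G'`, then strong clique immersions in `G'` give strong clique immersions in `G`. -/
theorem HasStrongCliqueImmersion.transfer {V : Type*} {G' G : SimpleGraph V} {t : ℕ} (ht : 2 ≤ t)
    (own : Sym2 V → Sym2 V) (Z : Set V) (hZ : ∀ z ∈ Z, ∀ w, ¬ G'.Adj z w)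
    (h : ∀ a b, G'.Adj a b → ∃ p : G.Walk a b, (∀ e ∈ p.edges, own e = s(a, b)) ∧
      ∀ c ∈ p.support, c = a ∨ c = b ∨ c ∈ Z)
    (hG : G'.HasStrongCliqueImmersion t) : G.HasStrongCliqueImmersion t := by
  obtain ⟨I⟩ := hG
  have expand : ∀ {a b : V} (p : G'.Walk a b), ∃ q : G.Walk a b,
      (∀ e ∈ q.edges, own e ∈ p.edges) ∧ ∀ c ∈ q.support, c ∈ p.support ∨ c ∈ Z := by
    intro a b p
    induction p with
    | nil => exact ⟨Walk.nil, by simp, by simp⟩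
    | cons hab p ih =>
      obtain ⟨q, hq, hq'⟩ := ih
      obtain ⟨r, hr, hr'⟩ := h _ _ hab
      refine ⟨r.append q, fun e he => ?_, fun c hc => ?_⟩
      · rw [Walk.edges_append, List.mem_append] at he
        rw [Walk.edges_cons, List.mem_cons]
        exact he.imp (hr e) (hq e)
      · rw [Walk.mem_support_append_iff] at hc
        rw [Walk.support_cons, List.mem_cons]
        rcases hc with hc | hc
        · rcases hr' c hc with rfl | rfl | hc
          · exact Or.inl (Or.inl rfl)
          · exact Or.inl (Or.inr p.start_mem_support)
          · exact Or.inr hc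
        · rcases hq' c hc with hc | hc
          · exact Or.inl (Or.inr hc)
          · exact Or.inr hc
  -- Expansion adds only vertices of `Z`, so no end vertex may lie there. As `t ≥ 2`, each end
  -- vertex starts a nontrivial path and is not isolated in `G'`.
  have hend : ∀ k, I.φ k ∉ Z := by
    intro k hk
    have : Nontrivial (Fin t) := Fin.nontrivial_iff_two_le.2 ht
    obtain ⟨j, hj⟩ := exists_ne k
    obtain ⟨_, hadj, _, _⟩ := Walk.exists_eq_cons_of_ne (I.φ.injective.ne hj.symm)
      (I.path k j hj.symm)
    exact hZ _ hk _ hadj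
  refine hasStrongCliqueImmersion_of_walks I.φ
    (fun i j => {e | ∃ h : i ≠ j, own e ∈ (I.path i j h).edges}) ?_ ?_
  · rintro e i j i' j' hij hij' ⟨h1, he1⟩ ⟨h2, he2⟩
    by_contra hne
    refine I.edge_disjoint i j h1 i' j' h2 ?_ he1 he2
    intro heq
    rcases Sym2.eq_iff.1 heq with h | h
    · exact hne h
    · obtain ⟨rfl, rfl⟩ := h
      exact lt_asymm hij hij'
  · intro i j hij
    obtain ⟨q, hq, hq'⟩ := expand (I.path i j hij.ne)
    refine ⟨q, fun e he => ⟨hij.ne, hq e he⟩, fun k hk => ?_⟩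
    exact I.internal i j hij.ne k ((hq' _ hk).resolve_right (hend k))

theorem HasStrongCliqueImmersion.mono {V : Type*} {G' G : SimpleGraph V} (hle : G' ≤ G) {t : ℕ}
    (ht : 2 ≤ t) (h : G'.HasStrongCliqueImmersion t) : G.HasStrongCliqueImmersion t := by
  refine h.transfer ht id ∅ (by simp) fun a b hab => ⟨(hle hab).toWalk, ?_, ?_⟩
  · simp
  · simp

/-- `f` pairs up the elements of `W`, paired elements being distinct and non-adjacent. -/
def IsNonadjPairing {V : Type*} (G : SimpleGraph V) (W : Finset V) (f : V → V) : Prop :=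
  ∀ a ∈ W, f a ∈ W ∧ f (f a) = a ∧ f a ≠ a ∧ ¬ G.Adj a (f a)

/-- The graph obtained by isolating `v` and joining the pairs `a, f a` with `a ∈ W`. -/
def splitOff {V : Type*} (G : SimpleGraph V) (v : V) (W : Finset V) (f : V → V) :
    SimpleGraph V where
  Adj a b := a ≠ v ∧ b ≠ v ∧ a ≠ b ∧ (G.Adj a b ∨ (a ∈ W ∧ b ∈ W ∧ f a = b ∧ f b = a))
  symm := ⟨fun _ _ h => ⟨h.2.1, h.1, h.2.2.1.symm,
    h.2.2.2.imp (fun h => h.symm) fun h => ⟨h.2.1, h.1, h.2.2.2, h.2.2.1⟩⟩⟩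
  loopless := ⟨fun _ h => h.2.2.1 rfl⟩

/-- A new edge `a b` is replaced by the walk `a v b`. The vertex `v` is isolated after the
splitting, and the edge `v a` serves only the pair of `a`. -/
theorem HasStrongCliqueImmersion.of_splitOff {V : Type*} {G : SimpleGraph V} {v : V}
    {W : Finset V} {f : V → V} (hW : ∀ a ∈ W, G.Adj v a) {t : ℕ} (ht : 2 ≤ t)
    (h : (G.splitOff v W f).HasStrongCliqueImmersion t) : G.HasStrongCliqueImmersion t := by
  classical
  let own : Sym2 V → Sym2 V := Sym2.lift ⟨fun a b => if a = v then s(b, f b) else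
    if b = v then s(a, f a) else s(a, b), by
      intro a b
      by_cases ha : a = v <;> by_cases hb : b = v <;> simp [ha, hb, Sym2.eq_swap]⟩
  refine h.transfer ht own {v} ?_ ?_
  · rintro z rfl w hw
    exact hw.1 rfl
  · rintro a b ⟨ha, hb, hab, hadj | ⟨haW, hbW, hfa, hfb⟩⟩
    · refine ⟨hadj.toWalk, ?_, ?_⟩
      · simp [own, ha, hb]
      · simp
    · refine ⟨Walk.cons (hW a haW).symm (hW b hbW).toWalk, ?_, ?_⟩
      · simp [own, hfa, hfb, Sym2.eq_swap]
      · simp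

/-! ### Immersions from large codegrees and from density. -/

section

open scoped Classical

variable {V : Type*}

theorem exists_injective_of_card_le {ι : Type*} [Fintype ι] (A : ι → Finset V)
    (h : ∀ i, Fintype.card ι ≤ (A i).card) : ∃ f : ι → V, f.Injective ∧ ∀ i, f i ∈ A i := by
  rw [← Finset.all_card_le_biUnion_card_iff_exists_injective]
  intro s
  rcases s.eq_empty_or_nonempty with rfl | ⟨i, hi⟩
  · simp
  · exact (Finset.card_le_univ s).trans ((h i).trans
      (Finset.card_le_card (Finset.subset_biUnion_of_mem A hi)))

theorem exists_embedding_of_le_card {B : Finset V} {t : ℕ} (h : t ≤ B.card) :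
    ∃ φ : Fin t ↪ V, ∀ i, φ i ∈ B :=
  ⟨(Fin.castLEEmb h).trans (B.equivFin.symm.toEmbedding.trans (Function.Embedding.subtype _)),
    fun i => by simp⟩

variable [Fintype V]

/-- The neighborhood of `v` as a finset. -/
noncomputable def nbhd (G : SimpleGraph V) (v : V) : Finset V := {w | G.Adj v w}

@[simp]
theorem mem_nbhd {G : SimpleGraph V} {v w : V} : w ∈ G.nbhd v ↔ G.Adj v w := by simp [nbhd]

/-- If `t` vertices have many common neighbors with `v`, they are the ends of a strong clique
immersion whose paths have length four and run through `v`. -/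
theorem hasStrongCliqueImmersion_of_codegree {G : SimpleGraph V} {t : ℕ} {v : V} {B : Finset V}
    (hB : t ≤ B.card) (hv : v ∉ B) (h : ∀ b ∈ B, t ^ 2 + t ≤ (G.nbhd v ∩ G.nbhd b).card) :
    G.HasStrongCliqueImmersion t := by
  obtain ⟨φ, hφ⟩ := exists_embedding_of_le_card hB
  -- One private vertex `w (i, j)` per ordered pair: `t ^ 2` choices to be distinct, and `t` more
  -- common neighbors to avoid the ends. The walk is `φ i, w (i, j), v, w (j, i), φ j`, and each of
  -- its edges identifies its pair by the unique `w`-vertex on it.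
  obtain ⟨w, hw, hwA⟩ := exists_injective_of_card_le (ι := Fin t × Fin t)
    (fun p => (G.nbhd v ∩ G.nbhd (φ p.1)) \ Finset.univ.image φ) (by
      intro p
      have h1 := Finset.le_card_sdiff (Finset.univ.image φ) (G.nbhd v ∩ G.nbhd (φ p.1))
      have h2 : (Finset.univ.image φ).card ≤ t := Finset.card_image_le.trans (by simp)
      have h3 := h _ (hφ p.1)
      simp only [Fintype.card_prod, Fintype.card_fin]
      nlinarith [Nat.sub_add_cancel (h2.trans (le_trans (Nat.le_add_left t (t ^ 2)) h3))])
  have hvw : ∀ p, G.Adj v (w p) := fun p => by have := hwA p; simp at this; exact this.1.1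
  have hφw : ∀ i j, G.Adj (φ i) (w (i, j)) := fun i j => by
    have := hwA (i, j); simp at this; exact this.1.2
  have hwφ : ∀ p i, w p ≠ φ i := fun p i hh => by
    have := hwA p; simp at this; exact this.2 i hh.symm
  have hwv : ∀ p, w p ≠ v := fun p => (hvw p).ne'
  have hφv : ∀ i, φ i ≠ v := fun i hh => hv (hh ▸ hφ i)
  refine hasStrongCliqueImmersion_of_walks φ (fun i j => {e | (w (i, j) ∈ e ∨ w (j, i) ∈ e) ∧
    ∀ p, w p ∈ e → p = (i, j) ∨ p = (j, i)}) ?_ ?_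
  · rintro e i j i' j' hij hij' ⟨h1, -⟩ ⟨-, h2⟩
    rcases h1 with h1 | h1 <;> rcases h2 _ h1 with h | h <;> simp only [Prod.mk.injEq] at h <;> omega
  · intro i j hij
    refine ⟨Walk.cons (hφw i j) (Walk.cons (hvw _).symm (Walk.cons (hvw (j, i))
      (hφw j i).symm.toWalk)), ?_, ?_⟩
    · simp [hwφ, hwv, hw.eq_iff]
    · intro k hk
      simp [hφv, (hwφ _ _).symm] at hk
      exact hk

/-- If every vertex of `S` has few non-neighbors in `S`, then any `t` vertices of `S` are the ends
of a strong clique immersion whose paths have length at most two. -/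
theorem hasStrongCliqueImmersion_of_dense {G : SimpleGraph V} {S : Finset V} {t s D : ℕ}
    (hS : S.card = t + s) (hD : ∀ v ∈ S, (S \ G.nbhd v).card ≤ D) (hs : 2 * D ≤ s) :
    G.HasStrongCliqueImmersion t := by
  obtain ⟨T, hTS, hT⟩ := Finset.exists_subset_card_eq (show t ≤ S.card by omega)
  -- Greedy choice of a middle vertex for each nonadjacent pair of `T`; only pairs that share a
  -- vertex need different middles.
  have key : ∀ P : Finset (Sym2 V), (∀ u v, s(u, v) ∈ P → u ∈ T ∧ v ∈ T ∧ u ≠ v ∧ ¬ G.Adj u v) →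
      ∃ w : Sym2 V → V, ∀ e ∈ P, w e ∈ S \ T ∧ (∀ x ∈ e, G.Adj x (w e)) ∧
        ∀ e' ∈ P, e ≠ e' → w e = w e' → ∀ x ∈ e, x ∉ e' := by
    intro P
    induction P using Finset.induction_on with
    | empty =>
      intro _
      by_cases hV : Nonempty V
      · exact ⟨fun _ => hV.some, by simp⟩
      · exact ⟨fun e => (hV ⟨e.out.1⟩).elim, by simp⟩
    | insert e P he ih =>
      intro hP
      obtain ⟨w, hw⟩ := ih fun u v h => hP u v (Finset.mem_insert_of_mem h)
      induction e using Sym2.ind with | _ u v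
      obtain ⟨huT, hvT, huv, hadj⟩ := hP u v (Finset.mem_insert_self _ _)
      -- Earlier pairs at `x` correspond to other non-neighbors of `x` in `T`. With the
      -- non-neighbors outside `T` and `x` itself they number at most `D`, so the two ends of a pair
      -- forbid at most `2 * D - 2 < s` middles.
      have bound : ∀ x ∈ T,
          (((S \ T) \ G.nbhd x) ∪ (P.filter (x ∈ ·)).image w).card + 1 ≤ D := by
        intro x hx
        have h1 : P.filter (x ∈ ·) ⊆ ((T \ G.nbhd x).erase x).image (fun y => s(x, y)) := by
          intro e he
          rw [Finset.mem_filter] at he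
          obtain ⟨heP, y, rfl⟩ := he
          obtain ⟨-, h2, h3, h4⟩ := hP _ _ (Finset.mem_insert_of_mem heP)
          exact Finset.mem_image.2 ⟨y, by simp [h2, h3.symm, h4], rfl⟩
        have h2 := (Finset.card_le_card h1).trans Finset.card_image_le
        have hx' : x ∈ T \ G.nbhd x := by simp [hx]
        rw [Finset.card_erase_of_mem hx'] at h2
        have h3 : 0 < (T \ G.nbhd x).card := Finset.card_pos.2 ⟨x, hx'⟩
        have h4 : ((S \ T) \ G.nbhd x).card + (T \ G.nbhd x).card = (S \ G.nbhd x).card := by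
          rw [← Finset.card_union_of_disjoint]
          · congr 1
            ext y
            have := @hTS y
            simp
            tauto
          · rw [Finset.disjoint_left]
            intro y
            simp
            tauto
        have h5 := hD x (hTS hx)
        have h6 := Finset.card_union_le ((S \ T) \ G.nbhd x) ((P.filter (x ∈ ·)).image w)
        have h7 : ((P.filter (x ∈ ·)).image w).card ≤ _ := Finset.card_image_le
        omega
      have hST : (S \ T).card = s := by rw [Finset.card_sdiff_of_subset hTS]; omega
      obtain ⟨z, hz, hz'⟩ : ∃ z ∈ S \ T, z ∉ (((S \ T) \ G.nbhd u) ∪ (P.filter (u ∈ ·)).image w) ∪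
          (((S \ T) \ G.nbhd v) ∪ (P.filter (v ∈ ·)).image w) := by
        by_contra! hcon
        have h1 := Finset.card_le_card (show S \ T ⊆ _ from hcon)
        have h2 := bound u huT
        have h3 := bound v hvT
        have h4 := h1.trans (Finset.card_union_le _ _)
        omega
      simp only [Finset.mem_union, Finset.mem_sdiff, mem_nbhd, Finset.mem_image, Finset.mem_filter,
        not_or, not_and, not_not, not_exists] at hz hz'
      obtain ⟨⟨hu1, hu2⟩, hv1, hv2⟩ := hz'
      refine ⟨Function.update w s(u, v) z, fun e' he' => ?_⟩
      have hne : ∀ e ∈ P, e ≠ s(u, v) := fun e h h' => he (h' ▸ h)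
      rcases Finset.mem_insert.1 he' with rfl | heP
      · refine ⟨by simpa using hz, by simpa using ⟨hu1 hz, hv1 hz⟩, fun e'' he'' hne' => ?_⟩
        have he3 := (Finset.mem_insert.1 he'').resolve_left hne'.symm
        rw [Function.update_self, Function.update_of_ne hne'.symm]
        intro hzw x hx hx'
        rcases Sym2.mem_iff.1 hx with rfl | rfl
        · exact hu2 e'' ⟨he3, hx'⟩ hzw.symm
        · exact hv2 e'' ⟨he3, hx'⟩ hzw.symm
      · rw [Function.update_of_ne (hne e' heP)]
        obtain ⟨h1, h2, h3⟩ := hw e' heP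
        refine ⟨h1, h2, fun e'' he'' hne' => ?_⟩
        rcases Finset.mem_insert.1 he'' with rfl | he''
        · rw [Function.update_self]
          intro hzw x hx hx'
          rcases Sym2.mem_iff.1 hx' with rfl | rfl
          · exact hu2 e' ⟨heP, hx⟩ hzw
          · exact hv2 e' ⟨heP, hx⟩ hzw
        · rw [Function.update_of_ne (hne e'' he'')]
          exact h3 e'' he'' hne'
  obtain ⟨w, hw⟩ := key (Finset.univ.filter fun e => ∃ u v, e = s(u, v) ∧ u ∈ T ∧ v ∈ T ∧ u ≠ v ∧
    ¬ G.Adj u v) (by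
      intro u v h
      simp only [Finset.mem_filter, Finset.mem_univ, true_and] at h
      obtain ⟨u', v', h, h'⟩ := h
      rcases Sym2.eq_iff.1 h with ⟨rfl, rfl⟩ | ⟨rfl, rfl⟩
      · exact h'
      · exact ⟨h'.2.1, h'.1, h'.2.2.1.symm, fun h => h'.2.2.2 h.symm⟩)
  obtain ⟨φ, hφ⟩ := exists_embedding_of_le_card hT.ge
  have hmem : ∀ i j, i ≠ j → ¬ G.Adj (φ i) (φ j) →
      s(φ i, φ j) ∈ Finset.univ.filter fun e => ∃ u v, e = s(u, v) ∧ u ∈ T ∧ v ∈ T ∧ u ≠ v ∧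
        ¬ G.Adj u v := fun i j hij h => by
    simp only [Finset.mem_filter, Finset.mem_univ, true_and]
    exact ⟨_, _, rfl, hφ i, hφ j, φ.injective.ne hij, h⟩
  have hwT : ∀ i j k, i ≠ j → ¬ G.Adj (φ i) (φ j) → w s(φ i, φ j) ≠ φ k := fun i j k hij h h' => by
    have := (hw _ (hmem i j hij h)).1
    rw [h'] at this
    exact (Finset.mem_sdiff.1 this).2 (hφ k)
  refine hasStrongCliqueImmersion_of_walks φ (fun i j => {e | e = s(φ i, φ j) ∨
    ¬ G.Adj (φ i) (φ j) ∧ ∃ x, x ∈ s(φ i, φ j) ∧ e = s(x, w s(φ i, φ j))}) ?_ ?_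
  · have hinj : ∀ i j i' j', i < j → i' < j' → s(φ i, φ j) = s(φ i', φ j') → i = i' ∧ j = j' := by
      intro i j i' j' hij hij' h
      rcases Sym2.eq_iff.1 h with ⟨h1, h2⟩ | ⟨h1, h2⟩
      · exact ⟨φ.injective h1, φ.injective h2⟩
      · have := φ.injective h1
        have := φ.injective h2
        omega
    rintro e i j i' j' hij hij' (rfl | ⟨hn, x, hx, rfl⟩) (h | ⟨hn', x', hx', h⟩)
    · exact hinj _ _ _ _ hij hij' h
    · have : w s(φ i', φ j') ∈ s(φ i, φ j) := h ▸ Sym2.mem_mk_right _ _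
      rcases Sym2.mem_iff.1 this with h | h
      · exact (hwT _ _ _ hij'.ne hn' h).elim
      · exact (hwT _ _ _ hij'.ne hn' h).elim
    · have : w s(φ i, φ j) ∈ s(φ i', φ j') := h ▸ Sym2.mem_mk_right _ _
      rcases Sym2.mem_iff.1 this with h | h
      · exact (hwT _ _ _ hij.ne hn h).elim
      · exact (hwT _ _ _ hij.ne hn h).elim
    · apply hinj _ _ _ _ hij hij'
      by_contra hne
      have hxx : x = x' ∧ w s(φ i, φ j) = w s(φ i', φ j') := by
        rcases Sym2.eq_iff.1 h with h | ⟨-, h⟩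
        · exact h
        · rcases Sym2.mem_iff.1 hx' with rfl | rfl
          · exact (hwT _ _ _ hij.ne hn h).elim
          · exact (hwT _ _ _ hij.ne hn h).elim
      exact (hw _ (hmem i j hij.ne hn)).2.2 _ (hmem i' j' hij'.ne hn') hne hxx.2 x hx (hxx.1 ▸ hx')
  · intro i j hij
    by_cases hadj : G.Adj (φ i) (φ j)
    · exact ⟨hadj.toWalk, by simp, by simp⟩
    · have h2 := (hw _ (hmem i j hij.ne hadj)).2.1
      refine ⟨Walk.cons (h2 _ (Sym2.mem_mk_left _ _)) (h2 _ (Sym2.mem_mk_right _ _)).symm.toWalk,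
        ?_, ?_⟩
      · intro e he
        refine Or.inr ⟨hadj, ?_⟩
        simp at he
        rcases he with rfl | rfl
        · exact ⟨_, Sym2.mem_mk_left _ _, rfl⟩
        · exact ⟨_, Sym2.mem_mk_right _ _, Sym2.eq_swap⟩
      · intro k hk
        simp [(hwT i j k hij.ne hadj).symm] at hk
        exact hk

end

/-! ### Logarithmic average degree. -/

section

open scoped Classical

variable {V : Type*}

theorem hasStrongCliqueImmersion_of_isClique {G : SimpleGraph V} {t : ℕ} {U : Finset V}
    (hU : G.IsClique U) (ht : t ≤ U.card) : G.HasStrongCliqueImmersion t := by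
  obtain ⟨φ, hφ⟩ := exists_embedding_of_le_card ht
  refine hasStrongCliqueImmersion_of_walks φ (fun i j => {s(φ i, φ j)}) ?_ fun i j hij =>
    ⟨(hU (hφ i) (hφ j) (φ.injective.ne hij.ne)).toWalk, by simp, by simp⟩
  rintro e i j i' j' hij hij' rfl h
  rcases Sym2.eq_iff.1 h with ⟨h1, h2⟩ | ⟨h1, h2⟩
  · exact ⟨φ.injective h1, φ.injective h2⟩
  · have := φ.injective h1
    have := φ.injective h2
    omega

/-- A maximal nonadjacent pairing leaves a clique. -/
theorem exists_isNonadjPairing_isClique (G : SimpleGraph V) (W : Finset V) :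
    ∃ W₀ ⊆ W, ∃ f, G.IsNonadjPairing W₀ f ∧ G.IsClique (W \ W₀ : Finset V) := by
  induction W using Finset.strongInduction with | _ W ih
  by_cases hW : G.IsClique W
  · exact ⟨∅, by simp, id, by simp [IsNonadjPairing], by simpa using hW⟩
  · simp only [IsClique, Set.Pairwise, not_forall] at hW
    obtain ⟨a, ha, b, hb, hab, hadj⟩ := hW
    rw [Finset.mem_coe] at ha hb
    obtain ⟨W₀, hW₀, f, hf, hc⟩ := ih ((W.erase a).erase b)
      (((Finset.erase_subset _ _).trans_ssubset (Finset.erase_ssubset ha)))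
    have haW : a ∉ W₀ := fun h => by simpa using hW₀ h
    have hbW : b ∉ W₀ := fun h => by simpa using hW₀ h
    refine ⟨insert a (insert b W₀), ?_, Function.update (Function.update f a b) b a, ?_, ?_⟩
    · intro x hx
      rcases Finset.mem_insert.1 hx with rfl | hx
      · exact ha
      rcases Finset.mem_insert.1 hx with rfl | hx
      · exact hb
      · exact Finset.mem_of_mem_erase (Finset.mem_of_mem_erase (hW₀ hx))
    · intro x hx
      rcases Finset.mem_insert.1 hx with rfl | hx
      · simp [Function.update_of_ne hab, hab.symm, hadj]
      rcases Finset.mem_insert.1 hx with rfl | hx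
      · simp [hab, G.adj_comm x a, hadj]
      · have hxa : x ≠ a := fun h => haW (h ▸ hx)
        have hxb : x ≠ b := fun h => hbW (h ▸ hx)
        obtain ⟨h1, h2, h3, h4⟩ := hf x hx
        have hfa : f x ≠ a := fun h => haW (h ▸ h1)
        have hfb : f x ≠ b := fun h => hbW (h ▸ h1)
        simp [Function.update_of_ne, hxa, hxb, hfa, hfb, h1, h2, h3, h4]
    · refine hc.subset fun x => ?_
      simp
      tauto

/-- The graph with the edges of `G` inside `S`. -/
def within (G : SimpleGraph V) (S : Finset V) : SimpleGraph V where
  Adj a b := G.Adj a b ∧ a ∈ S ∧ b ∈ S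
  symm := ⟨fun _ _ h => ⟨h.1.symm, h.2.2, h.2.1⟩⟩
  loopless := ⟨fun _ h => h.1.ne rfl⟩

theorem within_le (G : SimpleGraph V) (S : Finset V) : G.within S ≤ G := fun _ _ h => h.1

/-- The number of cliques inside `S`. -/
noncomputable def cliquesIn (G : SimpleGraph V) (S : Finset V) : ℕ :=
  (S.powerset.filter fun s : Finset V => G.IsClique s).card

theorem cliquesIn_le_two_pow (G : SimpleGraph V) (S : Finset V) : G.cliquesIn S ≤ 2 ^ S.card :=
  (Finset.card_filter_le _ _).trans (Finset.card_powerset S).le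

theorem cliquesIn_empty (G : SimpleGraph V) : G.cliquesIn ∅ = 1 := by
  simp [cliquesIn, Finset.filter_singleton]

variable [Fintype V]

theorem nbhd_erase_subset_nbhd_splitOff (G : SimpleGraph V) {v a : V} (W : Finset V) (f : V → V)
    (ha : a ≠ v) : (G.nbhd a).erase v ⊆ (G.splitOff v W f).nbhd a := by
  intro b hb
  simp only [Finset.mem_erase, mem_nbhd] at hb
  simp [splitOff, ha, hb.1, hb.2, hb.2.ne]

theorem card_nbhd_le_card_nbhd_splitOff_add_one (G : SimpleGraph V) {v a : V} (W : Finset V)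
    (f : V → V) (ha : a ≠ v) : (G.nbhd a).card ≤ ((G.splitOff v W f).nbhd a).card + 1 := by
  have h1 := Finset.card_le_card (G.nbhd_erase_subset_nbhd_splitOff W f ha)
  have h2 := Finset.pred_card_le_card_erase (s := G.nbhd a) (a := v)
  omega

theorem card_nbhd_le_card_nbhd_splitOff_of_not_adj (G : SimpleGraph V) {v a : V} (W : Finset V)
    (f : V → V) (ha : a ≠ v) (hadj : ¬ G.Adj v a) :
    (G.nbhd a).card ≤ ((G.splitOff v W f).nbhd a).card := by
  have h1 := Finset.card_le_card (G.nbhd_erase_subset_nbhd_splitOff W f ha)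
  rwa [Finset.erase_eq_of_notMem (by simpa using fun h => hadj (G.adj_symm h))] at h1

/-- The lost neighbor `v` is replaced by `f a`, which is new because the pair was nonadjacent. -/
theorem card_nbhd_le_card_nbhd_splitOff_of_mem {G : SimpleGraph V} {v a : V} {W : Finset V}
    {f : V → V} (hW : ∀ a ∈ W, G.Adj v a) (hf : G.IsNonadjPairing W f) (ha : a ∈ W) :
    (G.nbhd a).card ≤ ((G.splitOff v W f).nbhd a).card := by
  obtain ⟨h1, h2, h3, h4⟩ := hf a ha
  have hav : a ≠ v := (hW a ha).ne'
  have hsub : insert (f a) ((G.nbhd a).erase v) ⊆ (G.splitOff v W f).nbhd a := by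
    rw [Finset.insert_subset_iff]
    refine ⟨?_, G.nbhd_erase_subset_nbhd_splitOff W f hav⟩
    simp [splitOff, hav, (hW _ h1).ne', h3.symm, ha, h1, h2]
  have h5 := Finset.card_le_card hsub
  rw [Finset.card_insert_of_notMem (by simp [h4])] at h5
  have h6 := Finset.pred_card_le_card_erase (s := G.nbhd a) (a := v)
  omega

/-- A graph without strong `K_t`-immersion has average degree at most `t` times a harmonic
number. -/
theorem sum_card_nbhd_le {t : ℕ} (ht : 2 ≤ t) (m : ℕ) :
    ∀ (G : SimpleGraph V) (S : Finset V), S.card = m + 1 → (∀ a b, G.Adj a b → a ∈ S) →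
      ¬ G.HasStrongCliqueImmersion t →
      ((∑ v ∈ S, (G.nbhd v).card : ℕ) : ℚ) ≤ (m + 1) * (t * harmonic m) := by
  induction m with
  | zero =>
    intro G S hS hG _
    obtain ⟨a, rfl⟩ := Finset.card_eq_one.1 (by simpa using hS)
    have : G.nbhd a = ∅ := by
      ext b
      simp only [mem_nbhd, Finset.notMem_empty, iff_false]
      intro h
      have h1 := hG _ _ h.symm
      rw [Finset.mem_singleton] at h1
      exact h.ne h1.symm
    simp [this]
  | succ m ih =>
    intro G S hS hG hno
    obtain ⟨v, hv, hmin⟩ := Finset.exists_min_image S (fun v => (G.nbhd v).card)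
      (Finset.card_pos.1 (by omega))
    obtain ⟨W, hW, f, hf, hc⟩ := G.exists_isNonadjPairing_isClique (G.nbhd v)
    have hWv : ∀ a ∈ W, G.Adj v a := fun a ha => by simpa using hW ha
    have hU : (G.nbhd v \ W).card < t := by
      by_contra! h
      exact hno (hasStrongCliqueImmersion_of_isClique hc h)
    have hrec := ih (G.splitOff v W f) (S.erase v) (by rw [Finset.card_erase_of_mem hv]; omega) (by
      rintro a b ⟨h1, h2, h3, h | h⟩
      · exact Finset.mem_erase.2 ⟨h1, hG _ _ h⟩
      · exact Finset.mem_erase.2 ⟨h1, hG _ _ (hWv a h.1).symm⟩) fun h => hno (h.of_splitOff hWv ht)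
    -- Only the unpaired neighbors of `v` lose a degree, and as a clique they are fewer than `t`.
    have hsum : ∑ a ∈ S.erase v, (G.nbhd a).card ≤
        ∑ a ∈ S.erase v, ((G.splitOff v W f).nbhd a).card + (G.nbhd v \ W).card := by
      calc ∑ a ∈ S.erase v, (G.nbhd a).card
          ≤ ∑ a ∈ S.erase v, (((G.splitOff v W f).nbhd a).card +
              if a ∈ G.nbhd v \ W then 1 else 0) := by
            refine Finset.sum_le_sum fun a ha => ?_
            have hav := Finset.ne_of_mem_erase ha
            by_cases haU : a ∈ G.nbhd v \ W
            · simpa [haU] using G.card_nbhd_le_card_nbhd_splitOff_add_one W f hav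
            · rw [if_neg haU, add_zero]
              by_cases haW : a ∈ W
              · exact card_nbhd_le_card_nbhd_splitOff_of_mem hWv hf haW
              · refine G.card_nbhd_le_card_nbhd_splitOff_of_not_adj W f hav fun h => haU ?_
                simp [h, haW]
        _ ≤ _ := by
            rw [Finset.sum_add_distrib, Finset.sum_ite, Finset.sum_const_zero, add_zero,
              ← Finset.card_eq_sum_ones]
            refine Nat.add_le_add_left (Finset.card_le_card fun a ha => ?_) _
            exact (Finset.mem_filter.1 ha).2
    have h1 : S.card * (G.nbhd v).card ≤ ∑ a ∈ S, (G.nbhd a).card := by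
      rw [← smul_eq_mul]
      exact Finset.card_nsmul_le_sum _ _ _ hmin
    have h2 := Finset.add_sum_erase S (fun a => (G.nbhd a).card) hv
    rw [hS] at h1
    generalize ∑ a ∈ S, (G.nbhd a).card = D at *
    generalize ∑ a ∈ S.erase v, ((G.splitOff v W f).nbhd a).card = D' at *
    have h3 : D ≤ (G.nbhd v).card + D' + t := by omega
    generalize (G.nbhd v).card = d at *
    rw [harmonic_succ]
    have h4 : (D : ℚ) ≤ d + D' + t := by exact_mod_cast h3
    have h5 : ((m : ℚ) + 1 + 1) * d ≤ D := by exact_mod_cast h1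
    have hm : (0 : ℚ) < m + 1 := by positivity
    -- Minimality of `d` gives `d ≤ D / (m + 2)`, hence `D / (m + 2) ≤ D' / (m + 1) + t / (m + 1)`:
    -- the average grows by one harmonic term times `t`.
    have h6 : ((m : ℚ) + 1) * D ≤ (m + 1 + 1) * (D' + t) := by nlinarith
    have h7 : ((m : ℚ) + 1) * D ≤ (m + 1) * ((m + 1 + 1) * (t * (harmonic m + (m + 1 : ℚ)⁻¹))) := by
      have : (m + 1 : ℚ) * ((m + 1 + 1) * (t * (harmonic m + (m + 1 : ℚ)⁻¹))) =
        (m + 1 + 1) * ((m + 1) * (t * harmonic m) + t) := by field_simp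
      rw [this]
      nlinarith
    push_cast
    exact le_of_mul_le_mul_left h7 hm

theorem nbhd_within (G : SimpleGraph V) {S : Finset V} {v : V} (hv : v ∈ S) :
    (G.within S).nbhd v = S ∩ G.nbhd v := by
  ext w
  simp [within, hv, and_comm]

theorem exists_card_inter_nbhd_le_log {G : SimpleGraph V} {t : ℕ} (ht : 2 ≤ t)
    (hG : ¬ G.HasStrongCliqueImmersion t) {S : Finset V} (hS : S.Nonempty) :
    ∃ v ∈ S, ((S ∩ G.nbhd v).card : ℝ) ≤ t * (1 + Real.log S.card) := by
  obtain ⟨m, hm⟩ : ∃ m, S.card = m + 1 := ⟨S.card - 1, by have := hS.card_pos; omega⟩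
  have h1 := sum_card_nbhd_le ht m (G.within S) S hm (fun a b h => h.2.1)
    fun h => hG (h.mono (G.within_le S) ht)
  obtain ⟨v, hv, hmin⟩ := Finset.exists_min_image S (fun v => ((G.within S).nbhd v).card) hS
  refine ⟨v, hv, ?_⟩
  rw [← nbhd_within G hv]
  have h2 : (m + 1) * ((G.within S).nbhd v).card ≤ ∑ a ∈ S, ((G.within S).nbhd a).card := by
    rw [← hm, ← smul_eq_mul]
    exact Finset.card_nsmul_le_sum _ _ _ hmin
  have h3 : ((m : ℚ) + 1) * ((G.within S).nbhd v).card ≤ (m + 1) * (t * harmonic m) :=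
    le_trans (by exact_mod_cast h2) h1
  have h4 : (((G.within S).nbhd v).card : ℚ) ≤ t * harmonic m :=
    le_of_mul_le_mul_left h3 (by positivity)
  have h5 : (((G.within S).nbhd v).card : ℝ) ≤ t * (harmonic m : ℝ) := by exact_mod_cast h4
  refine h5.trans (mul_le_mul_of_nonneg_left ((harmonic_le_one_add_log m).trans ?_) (by positivity))
  rcases m.eq_zero_or_pos with rfl | hm0
  · simp [hm]
  · have : (m : ℝ) ≤ S.card := by rw [hm]; push_cast; linarith
    have := Real.log_le_log (by exact_mod_cast hm0) this
    linarith

/-! ### Counting cliques along orderings and in small sets. -/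

theorem cliquesIn_le_erase_add (G : SimpleGraph V) (S : Finset V) (v : V) :
    G.cliquesIn S ≤ G.cliquesIn (S.erase v) + G.cliquesIn (S ∩ G.nbhd v) := by
  have : (S.powerset.filter fun s : Finset V => G.IsClique s) ⊆
      ((S.erase v).powerset.filter fun s : Finset V => G.IsClique s) ∪
        ((S ∩ G.nbhd v).powerset.filter fun s : Finset V => G.IsClique s).image (insert v) := by
    intro s hs
    rw [Finset.mem_filter, Finset.mem_powerset] at hs
    rw [Finset.mem_union]
    by_cases hvs : v ∈ s
    · refine Or.inr (Finset.mem_image.2 ⟨s.erase v, ?_, Finset.insert_erase hvs⟩)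
      rw [Finset.mem_filter, Finset.mem_powerset]
      refine ⟨fun x hx => ?_, hs.2.subset (Finset.coe_subset.2 (Finset.erase_subset v s))⟩
      rw [Finset.mem_erase] at hx
      simpa using ⟨hs.1 hx.2, hs.2 hvs hx.2 hx.1.symm⟩
    · refine Or.inl (Finset.mem_filter.2 ⟨Finset.mem_powerset.2 fun x hx => ?_, hs.2⟩)
      exact Finset.mem_erase.2 ⟨fun h => hvs (h ▸ hx), hs.1 hx⟩
  exact (Finset.card_le_card this).trans ((Finset.card_union_le _ _).trans
    (Nat.add_le_add_left Finset.card_image_le _))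

/-- Cliques are counted along a degeneracy ordering. -/
theorem cliquesIn_le_of_degenerate {G : SimpleGraph V} {P : Finset V → Prop} {M : ℕ} {S : Finset V}
    (hP : ∀ T ⊆ S, T.Nonempty → ∃ v ∈ T, P (T ∩ G.nbhd v))
    (hM : ∀ T, P T → G.cliquesIn T ≤ M) : G.cliquesIn S ≤ S.card * M + 1 := by
  induction S using Finset.strongInduction with | _ S ih
  rcases S.eq_empty_or_nonempty with rfl | hS
  · simp [cliquesIn_empty]
  · obtain ⟨v, hv, hvM⟩ := hP S subset_rfl hS
    have h1 := ih (S.erase v) (Finset.erase_ssubset hv)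
      fun T hT => hP T (hT.trans (Finset.erase_subset _ _))
    have h2 := G.cliquesIn_le_erase_add S v
    have h3 := hM _ hvM
    rw [← Finset.card_erase_add_one hv]
    nlinarith

/-- A graph without strong `K_t`-immersion on fewer than `t + 2 ^ j` vertices has at most
`2 ^ (t + j (j + 1) / 2)` cliques. -/
theorem cliquesIn_le_two_pow_choose {G : SimpleGraph V} {t : ℕ}
    (hG : ¬ G.HasStrongCliqueImmersion t) (j : ℕ) :
    ∀ S : Finset V, S.card < t + 2 ^ j → G.cliquesIn S ≤ 2 ^ (t + (j + 1).choose 2) := by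
  induction j with
  | zero =>
    intro S hS
    exact (G.cliquesIn_le_two_pow S).trans (Nat.pow_le_pow_right (by norm_num) (by rw [pow_zero] at hS; omega))
  | succ j ih =>
    -- Vertices are removed one at a time until size `t`; each removed vertex has a neighborhood to
    -- which the bound for `j` applies.
    have step : ∀ s, s < 2 ^ (j + 1) → ∀ S : Finset V, S.card ≤ t + s →
        G.cliquesIn S ≤ (s + 1) * 2 ^ (t + (j + 1).choose 2) := by
      intro s
      induction s with
      | zero =>
        intro _ S hS
        refine (ih S (hS.trans_lt (by simp))).trans ?_
        simp
      | succ s ihs =>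
        intro hs S hS
        rcases hS.lt_or_eq with hS | hS
        · exact (ihs (by omega) S (by omega)).trans (Nat.mul_le_mul_right _ (by omega))
        -- By the density lemma some `v` misses more than `(s + 1) / 2` vertices, so its
        -- neighborhood in `S` has fewer than `t + (s + 1) / 2 < t + 2 ^ j` vertices.
        obtain ⟨v, hv, hlt⟩ : ∃ v ∈ S, s + 1 < 2 * (S \ G.nbhd v).card := by
          by_contra! hcon
          exact hG (hasStrongCliqueImmersion_of_dense (D := (s + 1) / 2) hS
            (fun v hv => by have := hcon v hv; omega) (by omega))
        have h1 := Finset.card_sdiff_add_card_inter S (G.nbhd v)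
        have h2 := ihs (by omega) (S.erase v) (by rw [Finset.card_erase_of_mem hv]; omega)
        have h3 := ih (S ∩ G.nbhd v) (by rw [pow_succ] at hs; omega)
        have h4 := G.cliquesIn_le_erase_add S v
        calc G.cliquesIn S ≤ _ := h4
          _ ≤ _ := Nat.add_le_add h2 h3
          _ = _ := by ring
    intro S hS
    rcases Nat.lt_or_ge S.card t with h | h
    · exact (G.cliquesIn_le_two_pow S).trans (Nat.pow_le_pow_right (by norm_num) (by omega))
    · have h1 := step (S.card - t) (by omega) S (by omega)
      refine h1.trans ((Nat.mul_le_mul_right _ (show _ ≤ 2 ^ (j + 1) by omega)).trans_eq ?_)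
      rw [Nat.choose_succ_succ' (j + 1) 1, ← pow_add]
      simp
      ring

end

/-! ### Nonadjacent pairings and the cubic degree bound. -/

section

open scoped Classical

variable {V : Type*}

theorem IsNonadjPairing.union {G : SimpleGraph V} {W₁ W₂ : Finset V} {f₁ f₂ : V → V}
    (h₁ : G.IsNonadjPairing W₁ f₁) (h₂ : G.IsNonadjPairing W₂ f₂) (hd : Disjoint W₁ W₂) :
    ∃ f, G.IsNonadjPairing (W₁ ∪ W₂) f := by
  refine ⟨fun x => if x ∈ W₁ then f₁ x else f₂ x, fun a ha => ?_⟩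
  by_cases h : a ∈ W₁
  · obtain ⟨h1, h2, h3, h4⟩ := h₁ a h
    simp [h, h1, h2, h3, h4]
  · have ha2 := (Finset.mem_union.1 ha).resolve_left h
    obtain ⟨h1, h2, h3, h4⟩ := h₂ a ha2
    have := Finset.disjoint_right.1 hd h1
    simp [h, h1, h2, h3, h4, this]

theorem exists_isNonadjPairing_of_injective {G : SimpleGraph V} {P : Finset V} (g : P → V)
    (hg : g.Injective) (hP : ∀ p, g p ∉ P) (hadj : ∀ p : P, ¬ G.Adj p (g p)) :
    ∃ f, G.IsNonadjPairing (P ∪ Finset.univ.image g) f := by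
  refine ⟨fun x => if h : x ∈ P then g ⟨x, h⟩ else if h : ∃ p, g p = x then h.choose else x,
    fun a ha => ?_⟩
  have hinv : ∀ p : P, ∀ h : ∃ q, g q = g p, h.choose = p := fun p h => hg h.choose_spec
  by_cases h : a ∈ P
  · have hne : g ⟨a, h⟩ ≠ a := fun h' => hP ⟨a, h⟩ (by rwa [h'])
    simp only [h, dite_true, hP, dite_false]
    refine ⟨by simp, ?_, hne, hadj ⟨a, h⟩⟩
    rw [dif_pos ⟨_, rfl⟩, hinv]
  · obtain ⟨p, -, rfl⟩ := Finset.mem_image.1 ((Finset.mem_union.1 ha).resolve_left h)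
    have hex : ∃ q, g q = g p := ⟨p, rfl⟩
    simp only [hP, dite_false, hex, dite_true, hinv]
    refine ⟨by simp, by simp, fun h' => hP p (h' ▸ p.2), fun h' => hadj p (G.adj_symm h')⟩

theorem card_sdiff_le_card_sdiff_add_card_sdiff (A B C : Finset V) :
    (A \ C).card ≤ (A \ B).card + (B \ C).card := by
  refine (Finset.card_le_card (t := (A \ B) ∪ (B \ C)) fun x => ?_).trans (Finset.card_union_le _ _)
  simp
  tauto

variable [Fintype V]

/-- Hall's theorem for non-adjacency between two halves of `W`. More than `s` vertices of one half
have no common neighbor in the other, so together they reach all of it; a single vertex already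
reaches at least `|W| / 2 - s ≥ s` vertices. -/
theorem exists_isNonadjPairing_of_sparse {G : SimpleGraph V} {W : Finset V} {s : ℕ}
    (hev : Even W.card) (h : ∀ w ∈ W, (W ∩ G.nbhd w).card ≤ s) (hW : 4 * s ≤ W.card) :
    ∃ f, G.IsNonadjPairing W f := by
  obtain ⟨m, hm⟩ := hev
  obtain ⟨P, hPW, hP⟩ := Finset.exists_subset_card_eq (show m ≤ W.card by omega)
  have hQ : (W \ P).card = m := by rw [Finset.card_sdiff_of_subset hPW]; omega
  obtain ⟨g, hg, hgm⟩ := (Finset.all_card_le_biUnion_card_iff_exists_injective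
    (fun p : P => (W \ P) \ G.nbhd p)).1 (by
      intro A
      rcases Nat.lt_or_ge s A.card with hA | hA
      · have : A.biUnion (fun p : P => (W \ P) \ G.nbhd p) = W \ P := by
          refine subset_antisymm (Finset.biUnion_subset.2 fun p _ => Finset.sdiff_subset) ?_
          intro q hq
          by_contra hcon
          simp only [Finset.mem_biUnion, not_exists, not_and] at hcon
          have hsub : A.map (Function.Embedding.subtype _) ⊆ W ∩ G.nbhd q := by
            intro x hx
            obtain ⟨p, hp, rfl⟩ := Finset.mem_map.1 hx
            have := hcon p hp
            rw [Finset.mem_sdiff, not_and_not_right] at this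
            exact Finset.mem_inter.2 ⟨hPW p.2, by simpa [G.adj_comm] using this hq⟩
          have h1 := Finset.card_le_card hsub
          rw [Finset.card_map] at h1
          have h2 := h q (Finset.mem_sdiff.1 hq).1
          omega
        rw [this, hQ]
        exact (Finset.card_le_univ A).trans (by simp [hP])
      · rcases A.eq_empty_or_nonempty with rfl | ⟨p, hp⟩
        · simp
        have h1 := Finset.card_le_card (Finset.subset_biUnion_of_mem
          (fun p : P => (W \ P) \ G.nbhd p) hp)
        have h2 := Finset.card_sdiff_add_card_inter (W \ P) (G.nbhd p)
        have h3 : ((W \ P) ∩ G.nbhd p).card ≤ s :=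
          (Finset.card_le_card (Finset.inter_subset_inter_right Finset.sdiff_subset)).trans
            (h p (hPW p.2))
        omega)
  obtain ⟨f, hf⟩ := exists_isNonadjPairing_of_injective (G := G) g hg
    (fun p => (Finset.mem_sdiff.1 (Finset.mem_sdiff.1 (hgm p)).1).2)
    (fun p => by simpa using (Finset.mem_sdiff.1 (hgm p)).2)
  have : P ∪ Finset.univ.image g = W := by
    refine Finset.eq_of_subset_of_card_le ?_ ?_
    · refine Finset.union_subset hPW fun x hx => ?_
      obtain ⟨p, -, rfl⟩ := Finset.mem_image.1 hx
      exact (Finset.mem_sdiff.1 (Finset.mem_sdiff.1 (hgm p)).1).1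
    · rw [Finset.card_union_of_disjoint, Finset.card_image_of_injective _ hg]
      · simp [hP, hm]
      · rw [Finset.disjoint_right]
        intro x hx
        obtain ⟨p, -, rfl⟩ := Finset.mem_image.1 hx
        exact (Finset.mem_sdiff.1 (Finset.mem_sdiff.1 (hgm p)).1).2
  exact ⟨f, this ▸ hf⟩

/-- A perfect nonadjacent pairing exists if few vertices have large degree, and none of them is
adjacent to almost everything. -/
theorem exists_isNonadjPairing {G : SimpleGraph V} {W : Finset V} {s r : ℕ}
    (hev : Even W.card) (hB : (W.filter fun w => s ≤ (W ∩ G.nbhd w).card).card ≤ r)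
    (hr : ∀ w ∈ W, 2 * r ≤ (W \ G.nbhd w).card) (hW : 4 * s + 2 * r ≤ W.card) :
    ∃ f, G.IsNonadjPairing W f := by
  set B := W.filter fun w => s ≤ (W ∩ G.nbhd w).card with hBdef
  have hBW : B ⊆ W := Finset.filter_subset _ _
  -- The at most `r` vertices of large degree are matched first, to distinct non-neighbors outside
  -- `B`. At least `4 * s` vertices remain, and they span a sparse graph.
  obtain ⟨g, hg, hgm⟩ := exists_injective_of_card_le (fun b : B => (W \ G.nbhd b) \ B) (by
    intro b
    have h1 := hr b (hBW b.2)
    have h2 := Finset.le_card_sdiff B (W \ G.nbhd b)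
    rw [Fintype.card_coe]
    omega)
  obtain ⟨f₁, hf₁⟩ := exists_isNonadjPairing_of_injective (G := G) g hg
    (fun p => (Finset.mem_sdiff.1 (hgm p)).2)
    (fun p => by simpa using (Finset.mem_sdiff.1 (Finset.mem_sdiff.1 (hgm p)).1).2)
  set W₁ := B ∪ Finset.univ.image g with hW₁
  have hW₁W : W₁ ⊆ W := by
    refine Finset.union_subset hBW fun x hx => ?_
    obtain ⟨p, -, rfl⟩ := Finset.mem_image.1 hx
    exact (Finset.mem_sdiff.1 (Finset.mem_sdiff.1 (hgm p)).1).1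
  have hcard : W₁.card = B.card + B.card := by
    rw [hW₁, Finset.card_union_of_disjoint, Finset.card_image_of_injective _ hg]
    · simp
    · rw [Finset.disjoint_right]
      intro x hx
      obtain ⟨p, -, rfl⟩ := Finset.mem_image.1 hx
      exact (Finset.mem_sdiff.1 (hgm p)).2
  have hcard2 := Finset.card_sdiff_add_card_eq_card hW₁W
  obtain ⟨f₂, hf₂⟩ := exists_isNonadjPairing_of_sparse (G := G) (W := W \ W₁) (s := s)
    (by
      obtain ⟨m, hm⟩ := hev
      exact ⟨m - B.card, by omega⟩)
    (fun w hw => by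
      rw [Finset.mem_sdiff] at hw
      have h1 : w ∉ B := fun h => hw.2 (Finset.mem_union_left _ h)
      simp only [hBdef, Finset.mem_filter, hw.1, true_and, not_le] at h1
      exact (Finset.card_le_card (Finset.inter_subset_inter_right Finset.sdiff_subset)).trans h1.le)
    (by omega)
  obtain ⟨f, hf⟩ := hf₁.union hf₂ Finset.disjoint_sdiff
  rw [Finset.union_sdiff_of_subset hW₁W] at hf
  exact ⟨f, hf⟩

/-- All vertices of `X` can be split off, at the expense of the degree of the common neighbor `y`
only. -/
theorem exists_isolate {t : ℕ} (ht : 2 ≤ t) (y : V) (X : Finset V) :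
    ∀ (G : SimpleGraph V) (S : Finset V), (∀ a b, G.Adj a b → a ∈ S) →
      ¬ G.HasStrongCliqueImmersion t → y ∉ X → (∀ x ∈ X, G.Adj x y) →
      (∀ x ∈ X, 4 * (t ^ 2 + t) + 2 * t + 1 ≤ (G.nbhd x \ X).card) →
      (∀ x ∈ X, ∀ w ∈ G.nbhd x \ X, 2 * t + 1 + X.card ≤ ((G.nbhd x \ X) \ G.nbhd w).card) →
      ∃ G' : SimpleGraph V, (∀ a b, G'.Adj a b → a ∈ S \ X) ∧ ¬ G'.HasStrongCliqueImmersion t ∧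
        (∀ v, v ∉ X → v ≠ y → (G.nbhd v).card ≤ (G'.nbhd v).card) ∧
        (G.nbhd y).card ≤ (G'.nbhd y).card + X.card := by
  induction X using Finset.induction_on with
  | empty =>
    intro G S hS hG _ _ _ _
    exact ⟨G, by simpa using hS, hG, by simp, by simp⟩
  | insert x X hx ih =>
    intro G S hS hG hy hadj hlarge hfar
    set W := G.nbhd x \ insert x X with hW
    have hxX : x ∈ insert x X := Finset.mem_insert_self _ _
    have hyx : y ≠ x := fun h => hy (h ▸ hxX)
    have hyX : y ∉ X := fun h => hy (Finset.mem_insert_of_mem h)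
    -- Parity is repaired by leaving out `y`, the only vertex allowed to lose degree.
    obtain ⟨W', hW'W, hW'ev, hW'c, hW'y⟩ : ∃ W' ⊆ W, Even W'.card ∧ W.card ≤ W'.card + 1 ∧
        ∀ a ∈ W, a ≠ y → a ∈ W' := by
      rcases Nat.even_or_odd W.card with h | h
      · exact ⟨W, subset_rfl, h, by omega, fun a ha _ => ha⟩
      · have hyW : y ∈ W := by simp [hW, hadj x hxX, hyx, hyX]
        refine ⟨W.erase y, Finset.erase_subset _ _, ?_, ?_,
          fun a ha hay => Finset.mem_erase.2 ⟨hay, ha⟩⟩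
        · rw [Finset.card_erase_of_mem hyW]
          exact Nat.Odd.sub_odd h odd_one
        · rw [Finset.card_erase_of_mem hyW]
          omega
    have hW'adj : ∀ a ∈ W', G.Adj x a := fun a ha => by
      simpa using (Finset.mem_sdiff.1 (hW'W ha)).1
    have hW'X : ∀ a ∈ W', a ∉ X := fun a ha h =>
      (Finset.mem_sdiff.1 (hW'W ha)).2 (Finset.mem_insert_of_mem h)
    -- More than `t` vertices of large degree in `W'` would have large codegree with `x` and give an
    -- immersion.
    obtain ⟨f, hf⟩ := exists_isNonadjPairing (G := G) (s := t ^ 2 + t) (r := t) hW'ev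
      (by
        by_contra! hcon
        refine hG (hasStrongCliqueImmersion_of_codegree (v := x) hcon.le ?_ ?_)
        · intro h
          exact (hW'adj x (Finset.mem_filter.1 h).1).ne rfl
        · intro b hb
          exact (Finset.mem_filter.1 hb).2.trans (Finset.card_le_card
            (Finset.inter_subset_inter_right fun a ha => by simpa using hW'adj a ha)))
      (fun w hw => by
        have h1 := hfar x hxX w (hW'W hw)
        rw [← hW] at h1
        have h2 : (W \ G.nbhd w).card ≤ (W' \ G.nbhd w).card + 1 := by
          have h3 : W \ G.nbhd w ⊆ insert y (W' \ G.nbhd w) := by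
            intro a ha
            rw [Finset.mem_sdiff] at ha
            by_cases hay : a = y
            · simp [hay]
            · exact Finset.mem_insert_of_mem (Finset.mem_sdiff.2 ⟨hW'y a ha.1 hay, ha.2⟩)
          exact (Finset.card_le_card h3).trans (Finset.card_insert_le _ _)
        omega)
      (by
        have := hlarge x hxX
        rw [← hW] at this
        omega)
    have hno : ¬ (G.splitOff x W' f).HasStrongCliqueImmersion t :=
      fun h => hG (h.of_splitOff hW'adj ht)
    have hne : ∀ x' ∈ X, x' ≠ x := fun x' hx' h => hx (h ▸ hx')
    have hset : ∀ x' ∈ X, (G.splitOff x W' f).nbhd x' \ X = G.nbhd x' \ insert x X := by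
      intro x' hx'
      ext w
      have h1 : x' ∉ W' := fun h => hW'X x' h hx'
      have h2 := hne x' hx'
      simp only [Finset.mem_sdiff, mem_nbhd, Finset.mem_insert, splitOff]
      constructor
      · rintro ⟨⟨_, h3, -, h4 | h4⟩, h5⟩
        · exact ⟨h4, not_or.2 ⟨h3, h5⟩⟩
        · exact (h1 h4.1).elim
      · rintro ⟨h3, h4⟩
        rw [not_or] at h4
        exact ⟨⟨h2, h4.1, h3.ne, Or.inl h3⟩, h4.2⟩
    obtain ⟨G', hG'S, hG', hdeg, hdegy⟩ := ih (G.splitOff x W' f) (S.erase x) (by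
        rintro a b ⟨h1, h2, h3, h | h⟩
        · exact Finset.mem_erase.2 ⟨h1, hS _ _ h⟩
        · exact Finset.mem_erase.2 ⟨h1, hS _ _ (hW'adj a h.1).symm⟩) hno hyX
      (fun x' hx' => ⟨hne x' hx', hyx, (hadj x' (Finset.mem_insert_of_mem hx')).ne,
        Or.inl (hadj x' (Finset.mem_insert_of_mem hx'))⟩)
      (fun x' hx' => by
        rw [hset x' hx']
        exact hlarge x' (Finset.mem_insert_of_mem hx'))
      -- Splitting gives `w` at most one new neighbor, `f w`; the term `X.card` in the hypothesis
      -- pays for one such loss per vertex of `X`.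
      (fun x' hx' w hw => by
        rw [hset x' hx'] at hw ⊢
        have h1 := hfar x' (Finset.mem_insert_of_mem hx') w hw
        rw [Finset.card_insert_of_notMem hx] at h1
        have h2 : (G.nbhd x' \ insert x X) \ G.nbhd w ⊆ insert (f w)
            ((G.nbhd x' \ insert x X) \ (G.splitOff x W' f).nbhd w) := by
          intro a ha
          simp only [Finset.mem_sdiff, Finset.mem_insert, mem_nbhd, splitOff] at ha ⊢
          tauto
        have h3 := (Finset.card_le_card h2).trans (Finset.card_insert_le _ _)
        omega)
    refine ⟨G', fun a b hab => ?_, hG', fun v hv hvy => ?_, ?_⟩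
    · have := hG'S a b hab
      simp at this ⊢
      tauto
    · rw [Finset.mem_insert, not_or] at hv
      refine le_trans ?_ (hdeg v hv.2 hvy)
      by_cases hvx : G.Adj x v
      · exact card_nbhd_le_card_nbhd_splitOff_of_mem hW'adj hf
          (hW'y v (by simp [hW, hvx, hv.1, hv.2]) hvy)
      · exact G.card_nbhd_le_card_nbhd_splitOff_of_not_adj W' f hv.1 hvx
    · have h1 := G.card_nbhd_le_card_nbhd_splitOff_add_one W' f hyx
      rw [Finset.card_insert_of_notMem hx]
      omega

/-- A graph in which all degrees but one are at least `10 t ^ 3` has a strong `K_t`-immersion. -/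
theorem hasStrongCliqueImmersion_of_minDegree {t : ℕ} (ht : 2 ≤ t) (S : Finset V) :
    ∀ (G : SimpleGraph V) (y : V), (∀ a b, G.Adj a b → a ∈ S) → y ∈ S →
      (∀ v ∈ S, v ≠ y → 10 * t ^ 3 ≤ (G.nbhd v).card) → 10 * t ^ 3 ≤ (G.nbhd y).card + t →
      G.HasStrongCliqueImmersion t := by
  induction S using Finset.strongInduction with | _ S ih
  intro G y hS hyS hdeg hdegy
  by_contra hG
  have ht2 : 2 * t ≤ t ^ 2 := by nlinarith
  have ht3 : 2 * t ^ 2 ≤ t ^ 3 := by nlinarith [sq_nonneg t]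
  -- The cluster: a largest set of at most `t` vertices around `y` whose members each miss at most
  -- `5 * t * (|X| - 1)` vertices of the neighborhood of `y`.
  obtain ⟨X, hX, hmax⟩ := Finset.exists_max_image
    (S.powerset.filter fun X => y ∈ X ∧ X.card ≤ t ∧
      ∀ x ∈ X, (G.nbhd y \ G.nbhd x).card + 5 * t ≤ 5 * t * X.card) Finset.card
    ⟨{y}, by simp [hyS]; omega⟩
  simp only [Finset.mem_filter, Finset.mem_powerset] at hX hmax
  obtain ⟨hXS, hyX, hXt, hXd⟩ := hX
  have hXd' : ∀ x ∈ X, (G.nbhd y \ G.nbhd x).card ≤ 5 * t ^ 2 := fun x hx => by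
    have h1 := hXd x hx
    have h2 : 5 * t * X.card ≤ 5 * t * t := Nat.mul_le_mul_left _ hXt
    nlinarith
  -- A neighbor `w` too close to `x` could join the cluster. If the cluster is full, its vertices
  -- other than `y`, together with `w`, are `t` vertices of large codegree with `y`.
  have hclosed : ∀ x ∈ X, ∀ w ∈ G.nbhd x \ X, 5 * t < (G.nbhd x \ G.nbhd w).card := by
    intro x hx w hw
    by_contra! hcon
    rw [Finset.mem_sdiff, mem_nbhd] at hw
    have h1 := card_sdiff_le_card_sdiff_add_card_sdiff (G.nbhd y) (G.nbhd x) (G.nbhd w)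
    have h2 : ∀ x' ∈ insert w X,
        (G.nbhd y \ G.nbhd x').card + 5 * t ≤ 5 * t * (insert w X).card := by
      intro x' hx'
      rw [Finset.card_insert_of_notMem hw.2, mul_add, mul_one]
      rcases Finset.mem_insert.1 hx' with rfl | hx'
      · have := hXd x hx
        omega
      · have := hXd x' hx'
        omega
    rcases hXt.lt_or_eq with h | h
    · have := hmax (insert w X) ⟨Finset.insert_subset (hS _ _ hw.1.symm) hXS,
        Finset.mem_insert_of_mem hyX, by rw [Finset.card_insert_of_notMem hw.2]; omega, h2⟩
      rw [Finset.card_insert_of_notMem hw.2] at this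
      omega
    · refine hG (hasStrongCliqueImmersion_of_codegree (v := y) (B := (insert w X).erase y) ?_
        (by simp) fun b hb => ?_)
      · rw [Finset.card_erase_of_mem (Finset.mem_insert_of_mem hyX),
          Finset.card_insert_of_notMem hw.2, h]
        omega
      · have h3 := h2 b (Finset.mem_of_mem_erase hb)
        rw [Finset.card_insert_of_notMem hw.2, h] at h3
        have h4 := Finset.card_sdiff_add_card_inter (G.nbhd y) (G.nbhd b)
        have h5 : 5 * t * (t + 1) = 5 * t ^ 2 + 5 * t := by ring
        omega
  have hXn : ∀ x ∈ X, 10 * t ^ 3 ≤ (G.nbhd x).card + t + 5 * t ^ 2 := fun x hx => by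
    have h1 := hXd' x hx
    have h2 := Finset.card_sdiff_add_card_inter (G.nbhd y) (G.nbhd x)
    have h3 := Finset.card_le_card (Finset.inter_subset_right (s₁ := G.nbhd y) (s₂ := G.nbhd x))
    omega
  -- A common neighbor of the whole cluster: at most `t + 5 * t ^ 3` neighbors of `y` are excluded.
  -- It becomes the exceptional vertex once the cluster is isolated, as it loses at most `|X| ≤ t`
  -- in degree.
  obtain ⟨y', hy', hy'X⟩ : ∃ y' ∈ G.nbhd y,
      y' ∉ X ∪ X.biUnion fun x => G.nbhd y \ G.nbhd x := by
    by_contra! hcon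
    have h1 := (Finset.card_le_card (show G.nbhd y ⊆ _ from hcon)).trans (Finset.card_union_le _ _)
    have h2 := Finset.card_biUnion_le_card_mul X (fun x => G.nbhd y \ G.nbhd x) _ hXd'
    have h3 : X.card * (5 * t ^ 2) ≤ t * (5 * t ^ 2) := Nat.mul_le_mul_right _ hXt
    have h4 : t * (5 * t ^ 2) = 5 * t ^ 3 := by ring
    omega
  simp only [Finset.mem_union, Finset.mem_biUnion, Finset.mem_sdiff, hy', true_and, not_or,
    not_exists, not_and, not_not, mem_nbhd] at hy'X
  obtain ⟨G', hG'S, hG', hdeg', hdegy'⟩ := exists_isolate ht y' X G S hS hG hy'X.1 hy'X.2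
    (fun x hx => by
      have h1 := hXn x hx
      have h2 := Finset.le_card_sdiff X (G.nbhd x)
      omega)
    (fun x hx w hw => by
      have h1 := hclosed x hx w hw
      have h2 := Finset.le_card_sdiff X (G.nbhd x \ G.nbhd w)
      rw [sdiff_right_comm]
      omega)
  have hy'S : y' ∈ S := hS _ _ (mem_nbhd.1 hy').symm
  refine hG' (ih (S \ X) ?_ G' y' hG'S (Finset.mem_sdiff.2 ⟨hy'S, hy'X.1⟩) ?_ ?_)
  · exact Finset.sdiff_ssubset hXS ⟨y, hyX⟩
  · intro v hv hvy'
    rw [Finset.mem_sdiff] at hv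
    exact (hdeg v hv.1 fun h => hv.2 (h ▸ hyX)).trans (hdeg' v hv.2 hvy')
  · have h1 := hdeg y' hy'S fun h => hy'X.1 (h ▸ hyX)
    omega

theorem exists_card_inter_nbhd_lt {G : SimpleGraph V} {t : ℕ} (ht : 2 ≤ t)
    (hG : ¬ G.HasStrongCliqueImmersion t) {S : Finset V} (hS : S.Nonempty) :
    ∃ v ∈ S, (S ∩ G.nbhd v).card ≤ 10 * t ^ 3 := by
  by_contra! hcon
  obtain ⟨y, hy⟩ := hS
  have h : ∀ v ∈ S, 10 * t ^ 3 ≤ ((G.within S).nbhd v).card := fun v hv => by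
    rw [nbhd_within G hv]
    exact (hcon v hv).le
  refine hG (HasStrongCliqueImmersion.mono (G.within_le S) ht
    (hasStrongCliqueImmersion_of_minDegree ht S _ y (fun a b h => h.2.1) hy (fun v hv _ => h v hv)
      ((h y hy).trans (Nat.le_add_right _ _))))

end

/-! ### The upper bound. -/

section

open scoped Classical

variable {V : Type*} [Fintype V]

theorem numCliques_eq_cliquesIn_univ (G : SimpleGraph V) :
    G.numCliques = G.cliquesIn Finset.univ := by
  rw [numCliques, cliquesIn, ← Set.ncard_coe_finset]
  congr 1
  ext s
  simp

/-- Two nested degeneracy orderings. The outer one confines the inner one to `10 * t ^ 3` vertices,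
which makes the logarithmic bound independent of the order of the graph. -/
theorem numCliques_le_of_two_pow {G : SimpleGraph V} {t j : ℕ} (ht : 2 ≤ t)
    (hj : t * Real.log (10 * t ^ 3) < 2 ^ j) (hG : ¬ G.HasStrongCliqueImmersion t) :
    G.numCliques ≤ Fintype.card V * (10 * t ^ 3 * 2 ^ (t + (j + 1).choose 2) + 1) + 1 := by
  rw [numCliques_eq_cliquesIn_univ]
  refine cliquesIn_le_of_degenerate (P := fun T => T.card ≤ 10 * t ^ 3)
    (fun T _ hT => exists_card_inter_nbhd_lt ht hG hT) fun T hT => ?_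
  refine (cliquesIn_le_of_degenerate (P := fun R => R.card < t + 2 ^ j) (fun R hR hRne => ?_)
    (cliquesIn_le_two_pow_choose hG j)).trans (by gcongr)
  obtain ⟨v, hv, hlog⟩ := exists_card_inter_nbhd_le_log ht hG hRne
  refine ⟨v, hv, ?_⟩
  have h1 : (R.card : ℝ) ≤ 10 * t ^ 3 := by
    exact_mod_cast (Finset.card_le_card hR).trans hT
  have h2 := Real.log_le_log (by exact_mod_cast hRne.card_pos) h1
  have h3 : (t : ℝ) * (1 + Real.log R.card) ≤ t * (1 + Real.log (10 * t ^ 3)) := by gcongr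
  have h4 : ((R ∩ G.nbhd v).card : ℝ) < t + 2 ^ j := by linarith
  exact_mod_cast h4

end

/-- The exponent must exceed 1 to absorb the logarithm, and stay below `√2` so that half its square,
the coefficient of `(log₂ t) ^ 2` in the final count, is below 1. -/
theorem eventually_mul_log_lt_rpow :
    ∀ᶠ t : ℕ in Filter.atTop, (t : ℝ) * Real.log (10 * t ^ 3) < (t : ℝ) ^ (1.2 : ℝ) := by
  have h := (isLittleO_log_rpow_atTop (show (0 : ℝ) < 0.2 by norm_num)).bound
    (show (0 : ℝ) < 1 / 5 by norm_num)
  filter_upwards [tendsto_natCast_atTop_atTop.eventually h, Filter.eventually_ge_atTop 10]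
    with t ht ht10
  have ht10' : (10 : ℝ) ≤ t := by exact_mod_cast ht10
  have ht0 : (0 : ℝ) < t := by linarith
  have hlog : 0 < Real.log t := Real.log_pos (by linarith)
  rw [Real.norm_of_nonneg hlog.le, Real.norm_of_nonneg (by positivity)] at ht
  have h1 : Real.log (10 * t ^ 3) ≤ 4 * Real.log t := by
    rw [Real.log_mul (by norm_num) (by positivity), Real.log_pow]
    have := Real.log_le_log (by norm_num) ht10'
    push_cast
    linarith
  rw [show (1.2 : ℝ) = 1 + 0.2 by norm_num, Real.rpow_add ht0, Real.rpow_one]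
  exact mul_lt_mul_of_pos_left (by linarith) ht0

theorem exists_numCliques_le : ∃ t₀ : ℕ, ∀ t : ℕ, t₀ ≤ t →
    ∀ (V : Type*) [Fintype V] [Nonempty V] (G : SimpleGraph V), ¬ G.HasStrongCliqueImmersion t →
      (G.numCliques : ℝ) ≤ (2 : ℝ) ^ ((t : ℝ) + Real.logb 2 t ^ 2) * (Fintype.card V : ℝ) := by
  obtain ⟨t₀, ht₀⟩ := Filter.eventually_atTop.1 eventually_mul_log_lt_rpow
  refine ⟨max t₀ (2 ^ 20), fun t ht V _ _ G hG => ?_⟩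
  have hlt := ht₀ t (le_of_max_le_left ht)
  have ht20 : 2 ^ 20 ≤ t := le_of_max_le_right ht
  have ht20' : (2 : ℝ) ^ (20 : ℝ) ≤ t := by
    rw [show (20 : ℝ) = (20 : ℕ) by norm_num, Real.rpow_natCast]
    exact_mod_cast ht20
  have ht0 : (0 : ℝ) < t := lt_of_lt_of_le (by positivity) ht20'
  set L := Real.logb 2 t with hL
  have hL20 : 20 ≤ L := (Real.le_logb_iff_rpow_le (by norm_num) ht0).2 ht20'
  have htL : (2 : ℝ) ^ L = t := Real.rpow_logb (by norm_num) (by norm_num) ht0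
  set j := ⌈1.2 * L⌉₊
  have hj1 : 1.2 * L ≤ j := Nat.le_ceil _
  have hj2 : j < 1.2 * L + 1 := Nat.ceil_lt_add_one (by positivity)
  have hj : (t : ℝ) * Real.log (10 * t ^ 3) < 2 ^ j := by
    refine hlt.trans_le ?_
    rw [← htL, ← Real.rpow_mul (by norm_num), ← Real.rpow_natCast]
    exact Real.rpow_le_rpow_of_exponent_le (by norm_num) (by linarith)
  have h1 := numCliques_le_of_two_pow (le_trans (by norm_num) ht20) hj hG
  have hn : 1 ≤ Fintype.card V := Fintype.card_pos
  generalize hM : 2 ^ (t + (j + 1).choose 2) = M at h1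
  have hM1 : 1 ≤ M := hM ▸ Nat.one_le_two_pow
  have ht1 : 1 ≤ t ^ 3 := Nat.one_le_pow _ _ (by omega)
  have hM2 : 1 ≤ t ^ 3 * M := Nat.mul_pos ht1 hM1
  -- The two summands 1 are absorbed by raising 10 to 12; 16 is a convenient power of two.
  have h2 : G.numCliques ≤ Fintype.card V * (16 * (t ^ 3 * M)) := by nlinarith
  have h3 : (G.numCliques : ℝ) ≤ Fintype.card V * (16 * (t ^ 3 * M)) := by exact_mod_cast h2
  refine h3.trans ?_
  rw [mul_comm]
  refine mul_le_mul_of_nonneg_right ?_ (by positivity)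
  have hMr : (M : ℝ) = (2 : ℝ) ^ ((t : ℝ) + (j + 1) * j / 2) := by
    rw [← hM]
    push_cast
    rw [← Real.rpow_natCast]
    push_cast [Nat.cast_choose_two]
    simp
  have ht3 : (t : ℝ) ^ 3 = (2 : ℝ) ^ (L * 3) := by
    rw [Real.rpow_mul (by norm_num), htL]
    norm_cast
  have h16 : (16 : ℝ) = (2 : ℝ) ^ (4 : ℝ) := by norm_num
  rw [hMr, ht3, h16, ← Real.rpow_add (by norm_num), ← Real.rpow_add (by norm_num)]
  refine Real.rpow_le_rpow_of_exponent_le (by norm_num) ?_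
  -- What remains is `0.72 L ^ 2 + 4.8 L + 5 ≤ L ^ 2`, which holds for `L ≥ 20`; hence the threshold
  -- `2 ^ 20`.
  have hjj : ((j : ℝ) + 1) * j ≤ (1.2 * L + 2) * (1.2 * L + 1) :=
    mul_le_mul (by linarith) hj2.le (by positivity) (by positivity)
  nlinarith

/-! ### The extremal construction. -/

theorem HasStrongCliqueImmersion.hasWeakCliqueImmersion {V : Type*} {G : SimpleGraph V} {t : ℕ}
    (h : G.HasStrongCliqueImmersion t) : G.HasWeakCliqueImmersion t :=
  h.map fun I => I.toWeakImmersion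

/-- Some end vertex lies outside `K`. The first edges of its `t - 1` paths are distinct and lead
into `K`, which has only `t - 2` vertices. -/
theorem not_hasWeakCliqueImmersion_cliqueWithPendants {V : Type*} {K : Finset V} {t : ℕ}
    (ht : 2 ≤ t) (hK : K.card = t - 2) :
    ¬ (cliqueWithPendants (K : Set V)).HasWeakCliqueImmersion t := by
  rintro ⟨I⟩
  obtain ⟨i, hi⟩ : ∃ i, I.φ i ∉ K := by
    by_contra! h
    have := Finset.card_le_card_of_injOn (s := Finset.univ) (t := K) I.φ (fun i _ => h i)
      I.φ.injective.injOn
    simp at this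
    omega
  have hx : ∀ j, ∃ x, ∀ h : i ≠ j, x ∈ K ∧ s(I.φ i, x) ∈ (I.path i j h).edges := by
    intro j
    by_cases h : i = j
    · exact ⟨I.φ i, fun h' => (h' h).elim⟩
    · obtain ⟨x, hadj, q, hq⟩ := Walk.exists_eq_cons_of_ne (I.φ.injective.ne h) (I.path i j h)
      refine ⟨x, fun _ => ⟨hadj.2.resolve_left hi, ?_⟩⟩
      rw [hq]
      simp
  choose x hx using hx
  have h1 := Finset.card_le_card_of_injOn (s := Finset.univ.erase i) (t := K) x
    (fun j hj => (hx j (Finset.ne_of_mem_erase hj).symm).1) (by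
      intro j hj j' hj' heq
      by_contra hne
      have hij := (Finset.ne_of_mem_erase hj).symm
      have hij' := (Finset.ne_of_mem_erase hj').symm
      refine I.edge_disjoint i j hij i j' hij' ?_ (hx j hij).2 (heq ▸ (hx j' hij').2)
      intro h
      rcases Sym2.eq_iff.1 h with h | h
      · exact hne h.2
      · exact hij' h.1)
  rw [Finset.card_erase_of_mem (Finset.mem_univ _), Finset.card_univ, Fintype.card_fin] at h1
  omega

theorem isClique_cliqueWithPendants_iff {V : Type*} {K s : Set V} :
    (cliqueWithPendants K).IsClique s ↔ (s \ K).Subsingleton := by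
  constructor
  · intro h a ha b hb
    by_contra hab
    exact (h ha.1 hb.1 hab).2.elim ha.2 hb.2
  · intro h a ha b hb hab
    refine ⟨hab, ?_⟩
    by_contra hcon
    rw [not_or] at hcon
    exact hab (h ⟨ha, hcon.1⟩ ⟨hb, hcon.2⟩)

theorem numCliques_cliqueWithPendants {V : Type*} [Fintype V] [DecidableEq V] (K : Finset V) :
    (cliqueWithPendants (K : Set V)).numCliques = 2 ^ K.card * (Kᶜ.card + 1) := by
  have hset : {s : Finset V | (cliqueWithPendants (K : Set V)).IsClique (s : Set V)} =
      (K.powerset ∪ (Kᶜ ×ˢ K.powerset).image fun p => insert p.1 p.2 : Finset (Finset V)) := by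
    ext s
    simp only [Set.mem_ofPred_eq, isClique_cliqueWithPendants_iff, Finset.coe_union,
      Set.mem_union, Finset.mem_coe, Finset.mem_powerset, Finset.mem_image, Finset.mem_product,
      Finset.mem_compl, Prod.exists]
    rw [← Finset.coe_sdiff]
    constructor
    · intro h
      rcases (s \ K).eq_empty_or_nonempty with h0 | ⟨v, hv⟩
      · exact Or.inl (Finset.sdiff_eq_empty_iff_subset.1 h0)
      · refine Or.inr ⟨v, s.erase v, ⟨(Finset.mem_sdiff.1 hv).2, fun w hw => ?_⟩,
          Finset.insert_erase (Finset.mem_sdiff.1 hv).1⟩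
        rw [Finset.mem_erase] at hw
        by_contra hwK
        exact hw.1 (h (Finset.mem_coe.2 (Finset.mem_sdiff.2 ⟨hw.2, hwK⟩)) (Finset.mem_coe.2 hv))
    · rintro (h | ⟨v, s', ⟨hv, hs'⟩, rfl⟩)
      · simp [Finset.sdiff_eq_empty_iff_subset.2 h]
      · intro a ha b hb
        have key : ∀ a, a ∈ ((insert v s' \ K : Finset V) : Set V) → a = v := by
          intro a ha
          rw [Finset.mem_coe, Finset.mem_sdiff, Finset.mem_insert] at ha
          exact ha.1.resolve_right fun h => ha.2 (hs' h)
        rw [key a ha, key b hb]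
  rw [numCliques, hset, Set.ncard_coe_finset, Finset.card_union_of_disjoint,
    Finset.card_image_of_injOn, Finset.card_product, Finset.card_powerset]
  · ring
  · rintro ⟨v, s⟩ hs ⟨v', s'⟩ hs' h
    simp only [Finset.coe_product, Set.mem_prod, Finset.mem_coe, Finset.mem_compl,
      Finset.mem_powerset] at hs hs' h
    have hv : v = v' := by
      have : v ∈ insert v' s' := h ▸ Finset.mem_insert_self v s
      exact (Finset.mem_insert.1 this).resolve_right fun h => hs.1 (hs'.2 h)
    subst hv
    rw [← Finset.erase_insert (fun h => hs.1 (hs.2 h)), h,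
      Finset.erase_insert (fun h => hs.1 (hs'.2 h))]
  · rw [Finset.disjoint_right]
    intro s hs hsK
    obtain ⟨⟨v, s'⟩, hp, rfl⟩ := Finset.mem_image.1 hs
    rw [Finset.mem_product, Finset.mem_compl] at hp
    exact hp.1 (Finset.mem_powerset.1 hsK (Finset.mem_insert_self v s'))

theorem two_rpow_mul_le_numCliques_cliqueWithPendants {t n : ℕ} (ht : 2 ≤ t) (hn : t - 2 ≤ n)
    {K : Finset (Fin n)} (hK : K.card = t - 2) :
    (2 : ℝ) ^ ((t : ℝ) + Real.logb 2 t ^ 2) * (n : ℝ) ≤ (2 : ℝ) ^ (4 * Real.logb 2 t ^ 2) *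
      ((cliqueWithPendants (K : Set (Fin n))).numCliques : ℝ) := by
  obtain ⟨m, rfl⟩ := Nat.exists_eq_add_of_le hn
  have ht' : (2 : ℝ) ≤ t := by exact_mod_cast ht
  have ht0 : (0 : ℝ) < t := by linarith
  rw [numCliques_cliqueWithPendants, Finset.card_compl, hK, Fintype.card_fin,
    Nat.add_sub_cancel_left]
  set L := Real.logb 2 t with hL
  have hL1 : 1 ≤ L := (Real.le_logb_iff_rpow_le (by norm_num) ht0).2 (by simpa using ht')
  have htL : (2 : ℝ) ^ L = t := Real.rpow_logb (by norm_num) (by norm_num) ht0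
  -- Bounding `n = t - 2 + m` by `t (m + 1)` leaves `L + 2 ≤ 3 L ^ 2`, true for `L ≥ 1` with
  -- equality at `t = 2`; this is where the constant 4 comes from.
  have h1 : ((t - 2 + m : ℕ) : ℝ) ≤ (2 : ℝ) ^ L * (m + 1) := by
    rw [htL, Nat.cast_add, Nat.cast_sub ht]
    push_cast
    nlinarith [show (0 : ℝ) ≤ m from Nat.cast_nonneg m]
  have h2 : ((2 ^ (t - 2) * (m + 1) : ℕ) : ℝ) = (2 : ℝ) ^ ((t : ℝ) - 2) * (m + 1) := by
    push_cast
    rw [← Real.rpow_natCast, Nat.cast_sub ht]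
    push_cast
    rfl
  rw [h2, ← mul_assoc, ← Real.rpow_add (by norm_num)]
  refine (mul_le_mul_of_nonneg_left h1 (by positivity)).trans ?_
  rw [← mul_assoc, ← Real.rpow_add (by norm_num)]
  refine mul_le_mul_of_nonneg_right ?_ (by positivity)
  exact Real.rpow_le_rpow_of_exponent_le (by norm_num) (by nlinarith)

end SimpleGraph

/-! ### The theorem. -/

theorem theorem1 :
    -- upper bound, for strong and for weak immersions
    (∃ t₀ : ℕ, ∀ t : ℕ, t₀ ≤ t →
      ∀ (V : Type*) [Fintype V] [Nonempty V] (G : SimpleGraph V),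
        (¬ G.HasStrongCliqueImmersion t →
          (G.numCliques : ℝ) ≤ (2 : ℝ) ^ ((t : ℝ) + Real.logb 2 t ^ 2) * (Fintype.card V : ℝ)) ∧
        (¬ G.HasWeakCliqueImmersion t →
          (G.numCliques : ℝ) ≤ (2 : ℝ) ^ ((t : ℝ) + Real.logb 2 t ^ 2) * (Fintype.card V : ℝ))) ∧
    -- the construction
    (∀ (t n : ℕ), 2 ≤ t → t - 2 ≤ n →
      ∀ K : Finset (Fin n), K.card = t - 2 →
        ¬ (SimpleGraph.cliqueWithPendants (K : Set (Fin n))).HasWeakCliqueImmersion t ∧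
        ¬ (SimpleGraph.cliqueWithPendants (K : Set (Fin n))).HasStrongCliqueImmersion t ∧
        ((SimpleGraph.cliqueWithPendants (K : Set (Fin n))).numCliques : ℤ) =
          2 ^ (t - 2) * ((n : ℤ) - t + 3)) ∧
    -- sharpness of the upper bound up to a factor `2 ^ O(log ^ 2 t)`
    (∃ C : ℝ, ∀ (t n : ℕ), 2 ≤ t → t - 2 ≤ n →
      ∃ G : SimpleGraph (Fin n),
        ¬ G.HasWeakCliqueImmersion t ∧ ¬ G.HasStrongCliqueImmersion t ∧
        (2 : ℝ) ^ ((t : ℝ) + Real.logb 2 t ^ 2) * (n : ℝ) ≤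
          (2 : ℝ) ^ (C * Real.logb 2 t ^ 2) * (G.numCliques : ℝ)) := by
  refine ⟨?_, ?_, 4, ?_⟩
  · obtain ⟨t₀, ht₀⟩ := SimpleGraph.exists_numCliques_le
    exact ⟨t₀, fun t ht V _ _ G => ⟨ht₀ t ht V G,
      fun h => ht₀ t ht V G fun h' => h h'.hasWeakCliqueImmersion⟩⟩
  · intro t n ht hn K hK
    have h := SimpleGraph.not_hasWeakCliqueImmersion_cliqueWithPendants ht hK
    refine ⟨h, fun h' => h h'.hasWeakCliqueImmersion, ?_⟩
    rw [SimpleGraph.numCliques_cliqueWithPendants, Finset.card_compl, hK, Fintype.card_fin]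
    push_cast [Nat.cast_sub hn, Nat.cast_sub ht]
    ring
  · intro t n ht hn
    obtain ⟨K, -, hK⟩ := Finset.exists_subset_card_eq
      (show t - 2 ≤ (Finset.univ : Finset (Fin n)).card by simpa using hn)
    have h := SimpleGraph.not_hasWeakCliqueImmersion_cliqueWithPendants ht hK
    exact ⟨_, h, fun h' => h h'.hasWeakCliqueImmersion,
      SimpleGraph.two_rpow_mul_le_numCliques_cliqueWithPendants ht hn hK⟩
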